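/- Let $(\mathcal D,\nu_D)$, $(\mathcal A,\nu_A)$, $(\Theta,\nu_\Theta)$ each be either a countable discrete set with counting measure or an interval (a product of $n$ real intervals) in $\mathbb R^n$ with Lebesgue measure. Let $u_A(a,\theta)$, $u_D(d,\theta)$ be positive measurable utilities of an Attacker and a Defender, and $p_A(\theta\mid d,a)$, $p_D(\theta\mid d,a)$ positive, jointly measurable probability densities in $\theta$ with respect to $\nu_\Theta$. Assume that $\theta\mapsto u_A(a,\theta)p_A(\theta\mid d,a)$ and $\theta\mapsto u_D(d,\theta)p_D(\theta\mid d,a)$ are integrable for all $d,a$, and put $\psi_A(d,a)=\int u_A(a,\theta)p_A(\theta\mid d,a)\,d\theta$, $\psi_D(d,a)=\int u_D(d,\theta)p_D(\theta\mid d,a)\,d\theta$. Assume that for each $d$ the best response $a^*(d)=\arg\max_a\psi_A(d,a)$ exists, is unique and depends measurably on $d$, and that $d^*_{GT}=\arg\max_d\psi_D(d,a^*(d))$ exists and is unique (so $d^*_{GT}$ is the subgame-perfect defense). Assume also that $(a,\theta)\mapsto u_A(a,\theta)p_A(\theta\mid d,a)$ is integrable for each $d$, and that $(d,\theta)\mapsto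 u_D(d,\theta)p_D(\theta\mid d,a^*(d))$ is integrable. Let $g_A(\tilde a\mid a)$ and $g_D(\tilde d\mid d)$ be symmetric proposal densities with respect to $\nu_A$ and $\nu_D$, each irreducible: from every point, every set of positive reference measure is reached with positive probability by iterating the proposal. *Inner chain for the defense $d$.* Start at an arbitrary $a^{(0)}$ and $\theta^{(0)}\sim p_A(\cdot\mid d,a^{(0)})$. From $(a,\theta)$ draw $\tilde a\sim g_A(\cdot\mid a)$, $\tilde\theta\sim p_A(\cdot\mid d,\tilde a)$, and move to $(\tilde a,\tilde\theta)$ with probability $\min\{1,u_A(\tilde a,\tilde\theta)/u_A(a,\theta)\}$; otherwise stay. After $M$ steps a mode estimator applied to $a^{(K+1)},\dots,a^{(M)}$ gives the estimated response. *Outer chain.* Start at an arbitrary $d^{(0)}$ and draw $\theta^{(0)}\sim p_D(\cdot\mid d^{(0)},\hat a(d^{(0)}))$. From $(d,\theta)$ draw $\tilde d\sim g_D(\cdot\mid d)$, take the recorded response $\hat a(\tilde d)$, draw $\tilde\theta\sim p_D(\cdot\mid\tilde d,\hat a(\tilde d))$, and move to $(\tilde d,\tilde\theta)$ with probability $\min\{1,u_D(\tilde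 d,\tilde\theta)/u_D(d,\theta)\}$; otherwise stay. The output is a mode estimator applied to $d^{(R+1)},\dots,d^{(N)}$. In the *nested chain* the recorded response to each candidate $\tilde d$ (and to $d^{(0)}$) is the limit, as $M\to\infty$, of the estimates of the inner chain for that defense. A sequence of measurable estimators is called *consistent* for the mode of a density $f$ if, along every positive Harris recurrent Markov chain on (decision, outcome) pairs whose stationary distribution has decision-marginal of density $f$, and from every starting point, the estimates from the first $N$ decision draws converge almost surely, as $N\to\infty$, to the unique maximizer of $f$ whenever it exists (independent samples are a special case). Let the inner mode estimator be consistent for the marginal density of $a$ under $\pi_A(a,\theta\mid d)\propto u_A(a,\theta)p_A(\theta\mid d,a)$, for every $d$, and the outer one for the marginal density of $d$ under $\pi_D(d,\theta\mid a^*(d))\propto u_D(d,\theta)p_D(\theta\mid d,a^*(d))$. Then: 1. For each $d$, $\pi_A(\cdot\mid d)$ is a probability distribution, it is stationary for the inner chain, its $a$-marginal density has mode $a^*(d)$, and for every burn-in $K$ the estimated response converges to $a^*(d)$ almost surely as $M\to\infty$. 2. For every measurable table of recorded responses $r:\mathcal D\to\mathcal A$ such that $(d,\theta)\mapsto u_D(d,\theta)p_D(\theta\mid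 d,r(d))$ is integrable, $\pi_D(d,\theta\mid r(d))\propto u_D(d,\theta)p_D(\theta\mid d,r(d))$ is a probability distribution and is stationary for the outer chain with $\hat a=r$. 3. The nested chain is a well-defined Markov chain on $\mathcal D\times\Theta$; $\pi_D(d,\theta\mid a^*(d))$ is a probability distribution and is stationary for it; its $d$-marginal density has mode $d^*_{GT}$; and for all initial values $d^{(0)}$ and burn-ins $R$ the mode estimates based on $d^{(R+1)},\dots,d^{(N)}$ converge to $d^*_{GT}$ almost surely as $N\to\infty$. -/

import Mathlib

open MeasureTheory ProbabilityTheory Filter Topology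

noncomputable section

/-! ### Spaces with their reference measure -/

/-- `(X, ν)` is either a countable discrete set with counting measure (so that `∫ f ∂ν = ∑ f`), or
(via the topological identification `e`) an interval `∏ i, I i` of `ℝⁿ`, with Lebesgue measure. -/
class DiscreteOrInterval (X : Type*) [TopologicalSpace X] [MeasurableSpace X]
    (ν : Measure X) : Prop where
  discrete_or_interval :
    (Countable X ∧ DiscreteTopology X ∧ ν = Measure.count) ∨
    ∃ (n : ℕ) (I : Fin n → Set ℝ) (e : X → (Fin n → ℝ)),
      (∀ i, (I i).OrdConnected) ∧ IsEmbedding e ∧ Set.range e = Set.univ.pi I ∧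
        ν = (volume : Measure (Fin n → ℝ)).comap e

instance DiscreteOrInterval.sigmaFinite {X : Type*} [TopologicalSpace X] [MeasurableSpace X]
    [BorelSpace X] (ν : Measure X) [h : DiscreteOrInterval X ν] : SigmaFinite ν := by
  rcases h.discrete_or_interval with ⟨_, _, rfl⟩ | ⟨n, I, e, hI, he, hr, rfl⟩
  · infer_instance
  · have hm : MeasurableSet (Set.range e) := by
      rw [hr]
      exact MeasurableSet.univ_pi fun i => (hI i).measurableSet
    have hme : MeasurableEmbedding e := he.measurableEmbedding hm
    refine SigmaFinite.of_map _ hme.measurable.aemeasurable ?_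
    rw [hme.map_comap]
    infer_instance

/-! ### Markov chains -/

/-- The law on `ℕ → Z` of the time-homogeneous Markov chain with transition kernel `κ` and
initial law `init`. -/
def chainLaw {Z : Type*} [MeasurableSpace Z] (init : Measure Z) (κ : Kernel Z Z)
    [IsMarkovKernel κ] : Measure (ℕ → Z) :=
  Kernel.trajMeasure (X := fun _ => Z) init
    (fun n => κ.comap (fun x => x ⟨n, Finset.mem_Iic.2 le_rfl⟩) (measurable_pi_apply _))

/-- Harris recurrence with respect to `μ`: from every starting point, every set charged by `μ`
is almost surely visited at some time `≥ 1`. -/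
def HarrisRecurrent {Z : Type*} [MeasurableSpace Z] (κ : Kernel Z Z) [IsMarkovKernel κ]
    (μ : Measure Z) : Prop :=
  ∀ S : Set Z, MeasurableSet S → 0 < μ S →
    ∀ z : Z, ∀ᵐ x ∂(chainLaw (Measure.dirac z) κ), ∃ n : ℕ, x (n + 1) ∈ S

/-! ### Mode estimation -/

/-- `m` is the (unique) mode of `f`, i.e. its unique global maximizer. -/
def IsMode {X : Type*} (f : X → ℝ) (m : X) : Prop := ∀ x, x ≠ m → f x < f m

/-- The value of the estimator `T` on the `X`-marginal draws `z^(burn+1), …, z^(total)` of a path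
`z` in `X × Y`: the first `burn` draws after the initial state are discarded. -/
def modeEstimate {X Y : Type*} (T : (n : ℕ) → (Fin n → X) → X) (burn total : ℕ)
    (z : ℕ → X × Y) : X :=
  T (total - burn) (fun i => (z (burn + 1 + i)).1)

/-- `T` is a consistent estimator of the mode of the probability density `f` (with respect to `ν`)
from marginal samples: whenever a positive Harris recurrent Markov chain on `X × Y` has a
stationary distribution with `X`-marginal `f ∂ν`, the estimates computed from the first `N`
draws of its `X`-component converge almost surely to the mode of `f`, from every starting point.
(Independent samples are the special case of a constant kernel.) -/
def IsConsistentModeEstimator {X : Type*} [TopologicalSpace X] [MeasurableSpace X]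
    (ν : Measure X) (Y : Type*) [MeasurableSpace Y] (T : (n : ℕ) → (Fin n → X) → X)
    (f : X → ℝ) : Prop :=
  (∀ n, Measurable (T n)) ∧
  ∀ m : X, IsMode f m →
    ∀ (κ : Kernel (X × Y) (X × Y)) [IsMarkovKernel κ] (μ : Measure (X × Y))
      [IsProbabilityMeasure μ],
      κ.Invariant μ → HarrisRecurrent κ μ →
      μ.fst = ν.withDensity (fun x => ENNReal.ofReal (f x)) →
      ∀ z : X × Y, ∀ᵐ x ∂(chainLaw (Measure.dirac z) κ),
        Tendsto (fun N => modeEstimate T 0 N x) atTop (𝓝 m)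

/-! ### The Metropolis–Hastings accept/reject step -/

/-- Given (current state, candidate), move to the candidate with probability `α`, else stay, where
`α = min {1, u(candidate) / u(current)}`. -/
def acceptReject {Z : Type*} [MeasurableSpace Z] (u : Z → ℝ) (hu : Measurable u) :
    Kernel (Z × Z) Z where
  toFun p := ENNReal.ofReal (min 1 (u p.2 / u p.1)) • Measure.dirac p.2
    + (1 - ENNReal.ofReal (min 1 (u p.2 / u p.1))) • Measure.dirac p.1
  measurable' := by
    have hα : Measurable fun p : Z × Z => ENNReal.ofReal (min 1 (u p.2 / u p.1)) := by fun_prop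
    refine Measure.measurable_of_measurable_coe _ fun s hs => ?_
    simp only [Measure.coe_add, Measure.coe_smul, Pi.add_apply, Pi.smul_apply, smul_eq_mul,
      Measure.dirac_apply' _ hs]
    have h1 : Measurable fun p : Z × Z => s.indicator (1 : Z → ENNReal) p.1 :=
      (measurable_one.indicator hs).comp measurable_fst
    have h2 : Measurable fun p : Z × Z => s.indicator (1 : Z → ENNReal) p.2 :=
      (measurable_one.indicator hs).comp measurable_snd
    exact (hα.mul h2).add ((measurable_const.sub hα).mul h1)

instance {Z : Type*} [MeasurableSpace Z] (u : Z → ℝ) (hu : Measurable u) :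
    IsMarkovKernel (acceptReject u hu) := by
  refine ⟨fun p => ⟨?_⟩⟩
  simp [acceptReject]

/-- One Metropolis–Hastings transition: draw a candidate from `Q`, then accept or reject it. -/
def mhKernel {Z : Type*} [MeasurableSpace Z] (u : Z → ℝ) (hu : Measurable u)
    (Q : Kernel Z Z) : Kernel Z Z :=
  acceptReject u hu ∘ₖ (Kernel.id ×ₖ Q)

instance {Z : Type*} [MeasurableSpace Z] (u : Z → ℝ) (hu : Measurable u) (Q : Kernel Z Z)
    [IsMarkovKernel Q] : IsMarkovKernel (mhKernel u hu Q) := by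
  unfold mhKernel; infer_instance

/-! ### Proposal distributions -/

/-- A proposal generating distribution `g(x̃ ∣ x)`, written `g x̃ x`, given by densities with
respect to the reference measure `ν`. -/
structure Proposal (X : Type*) [MeasurableSpace X] (ν : Measure X) where
  g : X → X → ℝ
  measurable : Measurable (fun p : X × X => g p.1 p.2)
  nonneg : ∀ y x, 0 ≤ g y x
  lintegral_eq_one : ∀ x, ∫⁻ y, ENNReal.ofReal (g y x) ∂ν = 1

namespace Proposal

variable {X : Type*} [MeasurableSpace X] {ν : Measure X}

/-- Symmetry: `g(x̃ ∣ x) = g(x ∣ x̃)`. -/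
def Symmetric (G : Proposal X ν) : Prop := ∀ x y, G.g y x = G.g x y

/-- The kernel `x ↦ g(· ∣ x) ∂ν`. -/
def kernel [SFinite ν] (G : Proposal X ν) : Kernel X X :=
  Kernel.withDensity (Kernel.const X ν) (fun x y => ENNReal.ofReal (G.g y x))

instance [SFinite ν] (G : Proposal X ν) : IsMarkovKernel G.kernel := by
  refine ⟨fun x => ⟨?_⟩⟩
  have hm : Measurable (Function.uncurry fun x y => ENNReal.ofReal (G.g y x)) :=
    (G.measurable.comp measurable_swap).ennreal_ofReal
  rw [kernel, Kernel.withDensity_apply _ hm, Kernel.const_apply,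
    withDensity_apply _ MeasurableSet.univ, Measure.restrict_univ, G.lintegral_eq_one]

end Proposal

/-! ### The sequential game -/

/-- The data `(u_A, p_A)`, `(u_D, p_D)` of a sequential defend–attack game: utilities
`u_A(a, θ)`, `u_D(d, θ)`, and outcome densities `p_A(θ ∣ d, a)`, `p_D(θ ∣ d, a)` with respect to
`νΘ`, written `pA d a θ`, `pD d a θ`. -/
structure DefendAttackGame (D A Θ : Type*) [MeasurableSpace D] [MeasurableSpace A]
    [MeasurableSpace Θ] (νΘ : Measure Θ) where
  uA : A → Θ → ℝ
  uD : D → Θ → ℝ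
  pA : D → A → Θ → ℝ
  pD : D → A → Θ → ℝ
  measurable_uA : Measurable (fun z : A × Θ => uA z.1 z.2)
  measurable_uD : Measurable (fun z : D × Θ => uD z.1 z.2)
  measurable_pA : Measurable (fun z : (D × A) × Θ => pA z.1.1 z.1.2 z.2)
  measurable_pD : Measurable (fun z : (D × A) × Θ => pD z.1.1 z.1.2 z.2)
  nonneg_pA : ∀ d a θ, 0 ≤ pA d a θ
  nonneg_pD : ∀ d a θ, 0 ≤ pD d a θ
  lintegral_pA : ∀ d a, ∫⁻ θ, ENNReal.ofReal (pA d a θ) ∂νΘ = 1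
  lintegral_pD : ∀ d a, ∫⁻ θ, ENNReal.ofReal (pD d a θ) ∂νΘ = 1

namespace DefendAttackGame

variable {D A Θ : Type*} [MeasurableSpace D] [MeasurableSpace A] [MeasurableSpace Θ]
  {νΘ : Measure Θ}

/-- The Attacker's expected utility `ψ_A(d, a) = ∫ u_A(a, θ) p_A(θ ∣ d, a) dθ`. -/
def psiA (G : DefendAttackGame D A Θ νΘ) (d : D) (a : A) : ℝ :=
  ∫ θ, G.uA a θ * G.pA d a θ ∂νΘ

/-- The Defender's expected utility `ψ_D(d, a) = ∫ u_D(d, θ) p_D(θ ∣ d, a) dθ`. -/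
def psiD (G : DefendAttackGame D A Θ νΘ) (d : D) (a : A) : ℝ :=
  ∫ θ, G.uD d θ * G.pD d a θ ∂νΘ

/-- `θ ∼ p_A(θ ∣ d, a)`, as a kernel in `(d, a)`. -/
def outcomeA [SFinite νΘ] (G : DefendAttackGame D A Θ νΘ) : Kernel (D × A) Θ :=
  Kernel.withDensity (Kernel.const (D × A) νΘ) (fun x θ => ENNReal.ofReal (G.pA x.1 x.2 θ))

/-- `θ ∼ p_D(θ ∣ d, a)`, as a kernel in `(d, a)`. -/
def outcomeD [SFinite νΘ] (G : DefendAttackGame D A Θ νΘ) : Kernel (D × A) Θ :=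
  Kernel.withDensity (Kernel.const (D × A) νΘ) (fun x θ => ENNReal.ofReal (G.pD x.1 x.2 θ))

instance [SFinite νΘ] (G : DefendAttackGame D A Θ νΘ) : IsMarkovKernel G.outcomeA := by
  refine ⟨fun x => ⟨?_⟩⟩
  rw [outcomeA, Kernel.withDensity_apply _ G.measurable_pA.ennreal_ofReal, Kernel.const_apply,
    withDensity_apply _ MeasurableSet.univ, Measure.restrict_univ, G.lintegral_pA]

instance [SFinite νΘ] (G : DefendAttackGame D A Θ νΘ) : IsMarkovKernel G.outcomeD := by
  refine ⟨fun x => ⟨?_⟩⟩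
  rw [outcomeD, Kernel.withDensity_apply _ G.measurable_pD.ennreal_ofReal, Kernel.const_apply,
    withDensity_apply _ MeasurableSet.univ, Measure.restrict_univ, G.lintegral_pD]

/-! #### Augmented distributions -/

/-- The density of `π_A(a, θ ∣ d) ∝ u_A(a, θ) p_A(θ ∣ d, a)`. -/
def augDensityA (G : DefendAttackGame D A Θ νΘ) (νA : Measure A) (d : D) (z : A × Θ) : ℝ :=
  G.uA z.1 z.2 * G.pA d z.1 z.2 / ∫ w : A × Θ, G.uA w.1 w.2 * G.pA d w.1 w.2 ∂(νA.prod νΘ)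

/-- The augmented distribution `π_A(a, θ ∣ d)`. -/
def augA (G : DefendAttackGame D A Θ νΘ) (νA : Measure A) (d : D) : Measure (A × Θ) :=
  (νA.prod νΘ).withDensity (fun z => ENNReal.ofReal (G.augDensityA νA d z))

/-- The marginal density `π_A(a ∣ d) = ∫ π_A(a, θ ∣ d) dθ`. -/
def margDensityA (G : DefendAttackGame D A Θ νΘ) (νA : Measure A) (d : D) (a : A) : ℝ :=
  ∫ θ, G.augDensityA νA d (a, θ) ∂νΘ

/-- The density of `π_D(d, θ ∣ r(d)) ∝ u_D(d, θ) p_D(θ ∣ d, r(d))`, for a response map `r`. -/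
def augDensityD (G : DefendAttackGame D A Θ νΘ) (νD : Measure D) (r : D → A) (z : D × Θ) : ℝ :=
  G.uD z.1 z.2 * G.pD z.1 (r z.1) z.2 /
    ∫ w : D × Θ, G.uD w.1 w.2 * G.pD w.1 (r w.1) w.2 ∂(νD.prod νΘ)

/-- The augmented distribution `π_D(d, θ ∣ r(d))`. -/
def augD (G : DefendAttackGame D A Θ νΘ) (νD : Measure D) (r : D → A) : Measure (D × Θ) :=
  (νD.prod νΘ).withDensity (fun z => ENNReal.ofReal (G.augDensityD νD r z))

/-- The marginal density `π_D(d ∣ r(d)) = ∫ π_D(d, θ ∣ r(d)) dθ`. -/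
def margDensityD (G : DefendAttackGame D A Θ νΘ) (νD : Measure D) (r : D → A) (d : D) : ℝ :=
  ∫ θ, G.augDensityD νD r (d, θ) ∂νΘ

/-! #### The inner chain (`solve_attacker`) -/

section Inner

variable [SFinite νΘ] {νA : Measure A} [SFinite νA]

/-- Candidate of the inner chain for the defense `d`: `ã ∼ g_A(· ∣ a)`, then
`θ̃ ∼ p_A(· ∣ d, ã)`. -/
def innerCandidate (G : DefendAttackGame D A Θ νΘ) (gA : Proposal A νA) (d : D) :
    Kernel (A × Θ) (A × Θ) :=
  ((Kernel.id ×ₖ G.outcomeA.comap (fun a => (d, a)) measurable_prodMk_left) ∘ₖ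
    gA.kernel).comap Prod.fst measurable_fst

/-- Transition kernel of the inner chain for the defense `d`. -/
def innerKernel (G : DefendAttackGame D A Θ νΘ) (gA : Proposal A νA) (d : D) :
    Kernel (A × Θ) (A × Θ) :=
  mhKernel (fun z => G.uA z.1 z.2) G.measurable_uA (G.innerCandidate gA d)

instance (G : DefendAttackGame D A Θ νΘ) (gA : Proposal A νA) (d : D) :
    IsMarkovKernel (G.innerKernel gA d) := by
  unfold innerKernel innerCandidate; infer_instance

/-- Law of the trajectory `(a^(i), θ^(i))` of the inner chain for the defense `d`, with
`a^(0) = a₀` and `θ^(0) ∼ p_A(· ∣ d, a₀)`. -/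
def innerLaw (G : DefendAttackGame D A Θ νΘ) (gA : Proposal A νA) (d : D) (a₀ : A) :
    Measure (ℕ → A × Θ) :=
  chainLaw ((G.outcomeA (d, a₀)).map (fun θ => (a₀, θ))) (G.innerKernel gA d)

/-- Law of the best response recorded by `solve_attacker` for the defense `d` when the inner chain
is run to convergence: the limit, as the number `M` of inner draws grows, of the mode estimates
from the draws `a^(K+1), …, a^(M)`. -/
def responseLaw [TopologicalSpace A] [Nonempty A] (G : DefendAttackGame D A Θ νΘ)
    (gA : Proposal A νA) (TA : (n : ℕ) → (Fin n → A) → A) (K : ℕ) (a₀ : D → A) (d : D) :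
    Measure A :=
  (G.innerLaw gA d (a₀ d)).map (fun x => limUnder atTop (fun M => modeEstimate TA K M x))

end Inner

/-! #### The outer chain -/

section Outer

variable [SFinite νΘ] {νD : Measure D} [SFinite νD]

/-- `d ↦ (d, θ)`, where the recorded response `a ∼ solve(d)` to `d` is obtained first, and then
`θ ∼ p_D(· ∣ d, a)` is drawn. -/
def attachOutcome (G : DefendAttackGame D A Θ νΘ) (solve : Kernel D A) : Kernel D (D × Θ) :=
  Kernel.id ×ₖ (G.outcomeD ∘ₖ (Kernel.id ×ₖ solve))

/-- Candidate of the outer chain: `d̃ ∼ g_D(· ∣ d)`, the response `a` to `d̃` is obtained from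
`solve`, and `θ̃ ∼ p_D(· ∣ d̃, a)`. -/
def outerCandidate (G : DefendAttackGame D A Θ νΘ) (gD : Proposal D νD) (solve : Kernel D A) :
    Kernel (D × Θ) (D × Θ) :=
  (G.attachOutcome solve ∘ₖ gD.kernel).comap Prod.fst measurable_fst

/-- Transition kernel of the outer chain, with the responses of the Attacker given by `solve`. -/
def outerKernel (G : DefendAttackGame D A Θ νΘ) (gD : Proposal D νD) (solve : Kernel D A) :
    Kernel (D × Θ) (D × Θ) :=
  mhKernel (fun z => G.uD z.1 z.2) G.measurable_uD (G.outerCandidate gD solve)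

instance (G : DefendAttackGame D A Θ νΘ) (gD : Proposal D νD) (solve : Kernel D A)
    [IsMarkovKernel solve] : IsMarkovKernel (G.outerKernel gD solve) := by
  unfold outerKernel outerCandidate attachOutcome; infer_instance

/-- Law of the trajectory `(d^(i), θ^(i))` of the outer chain, with `d^(0) = d₀`. -/
def outerLaw (G : DefendAttackGame D A Θ νΘ) (gD : Proposal D νD) (solve : Kernel D A)
    [IsMarkovKernel solve] (d₀ : D) : Measure (ℕ → D × Θ) :=
  chainLaw (G.attachOutcome solve d₀) (G.outerKernel gD solve)

end Outer

end DefendAttackGame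

end

/-! Both levels of the algorithm are the same Metropolis–Hastings chain on (decision, outcome)
pairs: a candidate decision from a symmetric density g, then a candidate outcome from p. The target
is proportional to u·p, so p appears on both sides of detailed balance and only the ratio of the u's
is left: each flow equals min(u(z), u(y)) times a factor symmetric in z and y
(`mhKernel_invariant_augMeasure`). Integrating the outcome out of u·p gives ψ over the normalizing
constant, so the mode of the marginal is the maximizer of ψ.

Consistency of the mode estimator applies only to Harris recurrent chains, and Harris recurrence has
to be derived from irreducibility of the proposal. Positivity of u and p carries irreducibility over
to the chain. For a stationary irreducible chain, a set S of positive measure is then avoided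
forever with probability zero from almost every start (`avoidProb_ae_eq_zero`). A
Metropolis–Hastings step is an absolutely continuous part plus an atom at the current state, so an
exceptional start would have to be absorbing, which irreducibility forbids
(`harrisRecurrent_of_irreducible`).

Consistency speaks of deterministic starts and no burn-in; the Markov property extends it to any
initial law and burn-in (`IsConsistentModeEstimator.ae_tendsto`). Finally, the inner estimates
converge almost surely to the constant a*(d), so the recorded response has a Dirac law and the
nested chain is the outer chain run with the table a*. -/

/-! ### Path laws of Markov chains and the Markov property under time shifts. -/

section Chains

variable {Z : Type*} [MeasurableSpace Z]

/-- The one-step kernels, as functions of the past, of a time-homogeneous Markov chain. -/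
noncomputable def pastKernel (κ : Kernel Z Z) (n : ℕ) : Kernel (Finset.Iic n → Z) Z :=
  κ.comap (fun x => x ⟨n, Finset.mem_Iic.2 le_rfl⟩) (measurable_pi_apply _)

instance (κ : Kernel Z Z) [IsMarkovKernel κ] (n : ℕ) : IsMarkovKernel (pastKernel κ n) := by
  unfold pastKernel; infer_instance

/-- The law of the Markov chain as a kernel in its initial state. -/
noncomputable def pathKernel (κ : Kernel Z Z) [IsMarkovKernel κ] : Kernel Z (ℕ → Z) :=
  (Kernel.traj (X := fun _ => Z) (pastKernel κ) 0).comap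
    (MeasurableEquiv.piUnique (fun _ : Finset.Iic 0 => Z)).symm
    (MeasurableEquiv.measurable _)

instance (κ : Kernel Z Z) [IsMarkovKernel κ] : IsMarkovKernel (pathKernel κ) := by
  unfold pathKernel; infer_instance

/-- Disintegration over the initial state: what holds from every starting point passes to every
initial law. -/
lemma chainLaw_eq_bind (init : Measure Z) (κ : Kernel Z Z) [IsMarkovKernel κ] :
    chainLaw init κ = init.bind (pathKernel κ) := by
  ext s hs
  rw [Measure.bind_apply hs (Kernel.aemeasurable _)]
  change (Measure.bind _ _) s = _
  rw [Measure.bind_apply hs (Kernel.aemeasurable _),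
    lintegral_map (Kernel.measurable_coe _ hs) (MeasurableEquiv.measurable _)]
  rfl

lemma chainLaw_dirac (z : Z) (κ : Kernel Z Z) [IsMarkovKernel κ] :
    chainLaw (Measure.dirac z) κ = pathKernel κ z := by
  rw [chainLaw_eq_bind, Measure.dirac_bind (Kernel.measurable _)]

instance (init : Measure Z) [IsProbabilityMeasure init] (κ : Kernel Z Z) [IsMarkovKernel κ] :
    IsProbabilityMeasure (chainLaw init κ) := by
  rw [chainLaw_eq_bind]; infer_instance

/-- The Markov property as an identity of joint laws of past and next state; with the initial law it
characterizes the path law (`eq_of_markov`). -/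
lemma chainLaw_markov (init : Measure Z) [IsProbabilityMeasure init] (κ : Kernel Z Z)
    [IsMarkovKernel κ] (n : ℕ) :
    (chainLaw init κ).map (Preorder.frestrictLe n) ⊗ₘ pastKernel κ n =
      (chainLaw init κ).map (fun x => (Preorder.frestrictLe n x, x (n + 1))) :=
  Kernel.map_frestrictLe_trajMeasure_compProd_eq_map_trajMeasure (X := fun _ => Z)
    (κ := pastKernel κ)

lemma chainLaw_map_zero (init : Measure Z) (κ : Kernel Z Z)
    [IsMarkovKernel κ] : (chainLaw init κ).map (fun x => x 0) = init := by
  have h : ∀ z, (pathKernel κ z).map (fun x => x 0) = Measure.dirac z := by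
    intro z
    have h1 := Kernel.traj_map_frestrictLe_apply (X := fun _ => Z) (κ := pastKernel κ) (a := 0)
      0 ((MeasurableEquiv.piUnique (fun _ : Finset.Iic 0 => Z)).symm z)
    rw [Kernel.partialTraj_self, Kernel.id_apply] at h1
    have h2 := congrArg (Measure.map fun y : Finset.Iic 0 → Z => y ⟨0, by simp⟩) h1
    rw [Measure.map_map (by fun_prop) (by fun_prop), Measure.map_dirac' (by fun_prop)] at h2
    exact h2
  rw [chainLaw_eq_bind]
  ext s hs
  rw [Measure.map_apply (by fun_prop) hs,
    Measure.bind_apply (hs.preimage (by fun_prop)) (Kernel.aemeasurable _)]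
  simp_rw [← Measure.map_apply (μ := pathKernel κ _) (f := fun x : ℕ → Z => x 0)
    (measurable_pi_apply 0) hs, h, Measure.dirac_apply' _ hs]
  rw [lintegral_indicator_one hs]

/-- Two laws on paths agree as soon as their restrictions to finite initial segments do. -/
lemma Measure.ext_of_map_frestrictLe {P Q : Measure (ℕ → Z)} [IsFiniteMeasure P]
    (h : ∀ n, P.map (Preorder.frestrictLe n) = Q.map (Preorder.frestrictLe n)) : P = Q := by
  have hP : IsProjectiveMeasureFamily (α := fun _ : ℕ => Z)
      (fun I : Finset ℕ => P.map I.restrict) := by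
    intro I J hJI
    exact (Measure.map_map (Finset.measurable_restrict₂ hJI) (Finset.measurable_restrict I)).symm
  have hQ : IsProjectiveLimit Q (fun I : Finset ℕ => P.map I.restrict) :=
    (isProjectiveLimit_nat_iff (X := fun _ => Z) hP Q).2 fun n => (h n).symm
  exact IsProjectiveLimit.unique (fun _ => rfl) hQ

/-- A law on paths with the Markov property is determined by its initial law. -/
lemma eq_of_markov (κ : Kernel Z Z) [IsMarkovKernel κ] {P Q : Measure (ℕ → Z)}
    [IsFiniteMeasure P] (h0 : P.map (fun x => x 0) = Q.map (fun x => x 0))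
    (hP : ∀ n, P.map (Preorder.frestrictLe n) ⊗ₘ pastKernel κ n =
      P.map (fun x => (Preorder.frestrictLe n x, x (n + 1))))
    (hQ : ∀ n, Q.map (Preorder.frestrictLe n) ⊗ₘ pastKernel κ n =
      Q.map (fun x => (Preorder.frestrictLe n x, x (n + 1)))) : P = Q := by
  refine Measure.ext_of_map_frestrictLe fun n => ?_
  induction n with
  | zero =>
    have h := congrArg (Measure.map fun (z : Z) (_ : Finset.Iic 0) => z) h0
    rw [Measure.map_map (by fun_prop) (by fun_prop),
      Measure.map_map (by fun_prop) (by fun_prop)] at h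
    have e : ((fun (z : Z) (_ : Finset.Iic 0) => z) ∘ fun x : ℕ → Z => x 0)
        = Preorder.frestrictLe (π := fun _ => Z) 0 := by
      ext x ⟨i, hi⟩
      obtain rfl : i = 0 := by simpa using hi
      rfl
    rwa [e] at h
  | succ n ih =>
    have h : P.map (fun x => (Preorder.frestrictLe (π := fun _ => Z) n x, x (n + 1)))
        = Q.map (fun x => (Preorder.frestrictLe n x, x (n + 1))) := by
      rw [← hP, ← hQ, ih]
    -- `e` appends the next state to the past.
    let e : (Finset.Iic n → Z) × Z → (Finset.Iic (n + 1) → Z) := fun p i =>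
      if hi : i.1 ≤ n then p.1 ⟨i.1, Finset.mem_Iic.2 hi⟩ else p.2
    have he : Measurable e := by
      refine measurable_pi_lambda _ fun i => ?_
      by_cases hi : i.1 ≤ n
      · simp only [e, hi, dite_true]; fun_prop
      · simp only [e, hi, dite_false]; fun_prop
    have h' := congrArg (Measure.map e) h
    rw [Measure.map_map he (by fun_prop), Measure.map_map he (by fun_prop)] at h'
    have e' : (e ∘ fun x : ℕ → Z => (Preorder.frestrictLe (π := fun _ => Z) n x, x (n + 1)))
        = Preorder.frestrictLe (π := fun _ => Z) (n + 1) := by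
      ext x ⟨i, hi⟩
      rw [Finset.mem_Iic] at hi
      by_cases hin : i ≤ n
      · simp [e, hin]
      · obtain rfl : i = n + 1 := by omega
        simp [e]
    rwa [e'] at h'

lemma lintegral_chainLaw_succ (init : Measure Z) [IsProbabilityMeasure init] (κ : Kernel Z Z)
    [IsMarkovKernel κ] (n : ℕ) {F : (Finset.Iic n → Z) × Z → ENNReal} (hF : Measurable F) :
    ∫⁻ x, F (Preorder.frestrictLe n x, x (n + 1)) ∂(chainLaw init κ) =
      ∫⁻ x, ∫⁻ y, F (Preorder.frestrictLe n x, y) ∂(κ (x n)) ∂(chainLaw init κ) := by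
  have h := congrArg (fun μ => ∫⁻ p, F p ∂μ) (chainLaw_markov init κ n)
  rw [lintegral_map hF (by fun_prop), Measure.lintegral_compProd hF,
    lintegral_map hF.lintegral_kernel_prod_right' (by fun_prop)] at h
  exact h.symm

/-- The shifted chain is the chain started from the law of its first step. -/
lemma chainLaw_map_shift (init : Measure Z) [IsProbabilityMeasure init] (κ : Kernel Z Z)
    [IsMarkovKernel κ] :
    (chainLaw init κ).map (fun x n => x (n + 1)) = chainLaw (init.bind κ) κ := by
  have hsh : Measurable (fun (x : ℕ → Z) n => x (n + 1)) := by fun_prop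
  have : IsProbabilityMeasure ((chainLaw init κ).map (fun x n => x (n + 1))) :=
    Measure.isProbabilityMeasure_map hsh.aemeasurable
  refine eq_of_markov κ ?_ (fun n => ?_) (fun n => chainLaw_markov _ κ n)
  · rw [chainLaw_map_zero, Measure.map_map (by fun_prop) hsh]
    ext s hs
    rw [Measure.map_apply (by fun_prop) hs, Measure.bind_apply hs (Kernel.aemeasurable _)]
    have h := lintegral_chainLaw_succ init κ 0 (F := fun p => s.indicator 1 p.2)
      ((measurable_one.indicator hs).comp measurable_snd)
    simp only [lintegral_indicator_one hs] at h
    have h2 : ∫⁻ x, κ (x 0) s ∂(chainLaw init κ) = ∫⁻ z, κ z s ∂init := by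
      conv_rhs => rw [← chainLaw_map_zero init κ]
      rw [lintegral_map (Kernel.measurable_coe _ hs) (by fun_prop)]
    rw [← h2, ← h, ← lintegral_indicator_one (hs.preimage (by fun_prop))]
    rfl
  · refine Measure.ext_of_lintegral _ fun F hF => ?_
    -- The past of the shifted path up to `n` is the original past up to `n + 1` with time 0
    -- dropped, so the Markov property at `n + 1` is applied to a function that ignores that
    -- coordinate.
    let tl : (Finset.Iic (n + 1) → Z) → (Finset.Iic n → Z) := fun y i =>
      y ⟨i.1 + 1, Finset.mem_Iic.2 (Nat.succ_le_succ (Finset.mem_Iic.1 i.2))⟩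
    have htl : Measurable tl := by fun_prop
    have h := lintegral_chainLaw_succ init κ (n + 1) (F := fun p => F (tl p.1, p.2))
      (hF.comp (by fun_prop))
    have hFm : Measurable fun y => ∫⁻ b, F (y, b) ∂(pastKernel κ n y) :=
      hF.lintegral_kernel_prod_right'
    rw [Measure.map_map (by fun_prop) hsh, Measure.map_map (by fun_prop) hsh,
      Measure.lintegral_compProd hF, lintegral_map hFm (by fun_prop),
      lintegral_map hF (by fun_prop)]
    exact h.symm

/-- The law `μ` of the state at time `k` is left unspecified: it is only used for events that are
almost sure from every start. -/
lemma chainLaw_map_shift_iterate (init : Measure Z) [IsProbabilityMeasure init] (κ : Kernel Z Z)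
    [IsMarkovKernel κ] (k : ℕ) :
    ∃ μ : Measure Z, IsProbabilityMeasure μ ∧
      (chainLaw init κ).map (fun x n => x (k + n)) = chainLaw μ κ := by
  induction k with
  | zero => exact ⟨init, inferInstance, by simp⟩
  | succ k ih =>
    obtain ⟨μ, hμ, h⟩ := ih
    refine ⟨μ.bind κ, inferInstance, ?_⟩
    rw [← chainLaw_map_shift, ← h, Measure.map_map (by fun_prop) (by fun_prop)]
    congr 1
    ext x n
    exact congrArg x (by omega)

/-- An event that is almost sure from every starting point is almost sure after any number of
steps, for every initial law. -/
lemma ae_chainLaw_shift (init : Measure Z) [IsProbabilityMeasure init] (κ : Kernel Z Z)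
    [IsMarkovKernel κ] (k : ℕ) {p : (ℕ → Z) → Prop} (hp : MeasurableSet {x | p x})
    (h : ∀ z, ∀ᵐ x ∂(chainLaw (Measure.dirac z) κ), p x) :
    ∀ᵐ x ∂(chainLaw init κ), p (fun n => x (k + n)) := by
  obtain ⟨μ, hμ, hk⟩ := chainLaw_map_shift_iterate init κ k
  have h1 : ∀ᵐ x ∂(chainLaw μ κ), p x := by
    rw [chainLaw_eq_bind, Measure.ae_comp_iff hp]
    exact Eventually.of_forall fun z => by rw [← chainLaw_dirac]; exact h z
  rw [← hk] at h1
  exact ae_of_ae_map (f := fun (x : ℕ → Z) n => x (k + n))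
    (measurable_pi_lambda _ fun n => measurable_pi_apply (k + n)).aemeasurable h1

end Chains

/-! ### From irreducibility and stationarity to Harris recurrence. -/

section Recurrence

variable {Z : Type*} [MeasurableSpace Z]

/-- The probability that the chain never visits `S`, as a function of the initial state. -/
noncomputable def avoidProb (κ : Kernel Z Z) [IsMarkovKernel κ] (S : Set Z) (z : Z) : ENNReal :=
  pathKernel κ z {x | ∀ n, x n ∉ S}

lemma measurableSet_avoid {S : Set Z} (hS : MeasurableSet S) :
    MeasurableSet {x : ℕ → Z | ∀ n, x n ∉ S} := by
  simp only [Set.ofPred_forall]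
  exact MeasurableSet.iInter fun n => (hS.preimage (measurable_pi_apply n)).compl

lemma measurable_avoidProb (κ : Kernel Z Z) [IsMarkovKernel κ] {S : Set Z}
    (hS : MeasurableSet S) : Measurable (avoidProb κ S) :=
  Kernel.measurable_coe _ (measurableSet_avoid hS)

lemma avoidProb_le_one (κ : Kernel Z Z) [IsMarkovKernel κ] (S : Set Z) (z : Z) :
    avoidProb κ S z ≤ 1 := prob_le_one

lemma measure_avoid_succ (κ : Kernel Z Z) [IsMarkovKernel κ] {S : Set Z}
    (hS : MeasurableSet S) (z : Z) :
    pathKernel κ z {x | ∀ n, x (n + 1) ∉ S} = ∫⁻ y, avoidProb κ S y ∂(κ z) := by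
  have h := chainLaw_map_shift (Measure.dirac z) κ
  rw [Measure.dirac_bind (Kernel.measurable _), chainLaw_dirac, chainLaw_eq_bind] at h
  have h' := congrArg (fun μ : Measure (ℕ → Z) => μ {x | ∀ n, x n ∉ S}) h
  rw [Measure.bind_apply (measurableSet_avoid hS) (Kernel.aemeasurable _),
    Measure.map_apply (by fun_prop) (measurableSet_avoid hS)] at h'
  exact h'

lemma ae_pathKernel_zero (κ : Kernel Z Z) [IsMarkovKernel κ] {S : Set Z}
    (hS : MeasurableSet S) {z : Z} (hz : z ∈ S) : ∀ᵐ x ∂(pathKernel κ z), x 0 ∈ S := by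
  have h := chainLaw_map_zero (Measure.dirac z) κ
  rw [chainLaw_dirac] at h
  refine ae_of_ae_map (f := fun x : ℕ → Z => x 0) (measurable_pi_apply 0).aemeasurable
    (p := fun y => y ∈ S) ?_
  rw [h]
  exact (ae_dirac_iff hS).2 hz

lemma avoidProb_of_mem (κ : Kernel Z Z) [IsMarkovKernel κ] {S : Set Z}
    (hS : MeasurableSet S) {z : Z} (hz : z ∈ S) : avoidProb κ S z = 0 := by
  have h := ae_pathKernel_zero κ hS hz
  refine measure_mono_null (fun x hx => ?_) (ae_iff.1 h)
  exact hx 0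

/-- First-step analysis: off `S`, time 0 imposes no condition, so the avoidance probability is
harmonic there. -/
lemma avoidProb_of_notMem (κ : Kernel Z Z) [IsMarkovKernel κ] {S : Set Z}
    (hS : MeasurableSet S) {z : Z} (hz : z ∉ S) :
    avoidProb κ S z = ∫⁻ y, avoidProb κ S y ∂(κ z) := by
  rw [← measure_avoid_succ κ hS, avoidProb]
  refine measure_congr ?_
  filter_upwards [ae_pathKernel_zero κ hS.compl hz] with x hx
  refine propext ⟨fun h n => h (n + 1), fun h n => ?_⟩
  cases n with
  | zero => exact hx
  | succ n => exact h n

/-- For a stationary chain that reaches `S` from everywhere, almost every starting point leads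
to `S` almost surely. -/
lemma avoidProb_ae_eq_zero (κ : Kernel Z Z) [IsMarkovKernel κ] {π : Measure Z}
    [IsProbabilityMeasure π] (hinv : κ.Invariant π) {S : Set Z} (hS : MeasurableSet S)
    (hreach : ∀ z, ∃ n, 0 < (κ ^ n) z S) : ∀ᵐ z ∂π, avoidProb κ S z = 0 := by
  set f := avoidProb κ S with hf
  have hfm : Measurable f := measurable_avoidProb κ hS
  -- `f` vanishes on `S` and is harmonic off it, hence subharmonic. Stationarity gives both sides
  -- the same finite integral, so equality holds almost everywhere.
  have hle : f ≤ fun z => ∫⁻ y, f y ∂(κ z) := by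
    intro z
    by_cases hz : z ∈ S
    · rw [hf, avoidProb_of_mem κ hS hz]; exact zero_le
    · exact (avoidProb_of_notMem κ hS hz).le
  have hint : ∫⁻ z, ∫⁻ y, f y ∂(κ z) ∂π = ∫⁻ z, f z ∂π := by
    conv_rhs => rw [← hinv.def, Measure.lintegral_bind (Kernel.aemeasurable _) hfm.aemeasurable]
  have hfin : ∫⁻ z, f z ∂π ≠ ⊤ := by
    refine ne_top_of_le_ne_top ENNReal.one_ne_top ?_
    calc ∫⁻ z, f z ∂π ≤ ∫⁻ _, 1 ∂π := lintegral_mono (avoidProb_le_one κ S)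
      _ = 1 := by simp
  have hae : f =ᵐ[π] fun z => ∫⁻ y, f y ∂(κ z) :=
    ae_eq_of_ae_le_of_lintegral_le (ae_of_all _ hle) hfin
      hfm.lintegral_kernel.aemeasurable hint.le
  set E : Set Z := {z | f z ≠ 0} with hE
  have hEm : MeasurableSet E := (hfm (measurableSet_singleton 0)).compl
  -- Outside `E`, the chain almost surely does not enter `E`.
  have hout : ∀ᵐ z ∂π, z ∉ E → κ z E = 0 := by
    filter_upwards [hae] with z hz hzE
    have h0 : f z = 0 := by simpa [hE] using hzE
    rw [h0] at hz
    have := (lintegral_eq_zero_iff hfm).1 hz.symm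
    exact ae_iff.1 this
  -- Hence, by stationarity, it does not leave `E` either.
  have hin : ∀ᵐ z ∂π, z ∈ E → κ z Eᶜ = 0 := by
    have h1 : ∫⁻ z in E, κ z E ∂π = π E := by
      conv_rhs => rw [← hinv.def, Measure.bind_apply hEm (Kernel.aemeasurable _)]
      rw [← lintegral_add_compl (μ := π) (fun z => κ z E) hEm]
      have : ∫⁻ z in Eᶜ, κ z E ∂π = 0 := by
        rw [lintegral_eq_zero_iff (Kernel.measurable_coe _ hEm)]
        exact (ae_restrict_iff' hEm.compl).2 hout
      rw [this, add_zero]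
    have h2 : ∫⁻ z in E, κ z Eᶜ ∂π = 0 := by
      have h3 : ∫⁻ z in E, κ z E ∂π + ∫⁻ z in E, κ z Eᶜ ∂π = π E := by
        rw [← lintegral_add_left (Kernel.measurable_coe _ hEm)]
        simp [measure_add_measure_compl hEm]
      rw [h1] at h3
      exact (ENNReal.add_right_inj (measure_ne_top π E)).1 (h3.trans (add_zero _).symm)
    rw [lintegral_eq_zero_iff (Kernel.measurable_coe _ hEm.compl)] at h2
    exact (ae_restrict_iff' hEm).1 h2
  -- `E` is closed up to null sets: a law carried by `E` and absolutely continuous with respect to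
  -- `π` keeps both properties after a step.
  have hac1 : ∀ μ : Measure Z, μ ≪ π.restrict E → μ.bind κ ≪ π.restrict E := by
    intro μ hμ
    have hμπ : μ.bind κ ≪ π := by
      have := Measure.AbsolutelyContinuous.comp_right (κ := κ)
        (hμ.trans Measure.absolutelyContinuous_restrict)
      rwa [hinv.def] at this
    have hμE : μ.bind κ Eᶜ = 0 := by
      rw [Measure.bind_apply hEm.compl (Kernel.aemeasurable _),
        lintegral_eq_zero_iff (Kernel.measurable_coe _ hEm.compl)]
      exact hμ.ae_le ((ae_restrict_iff' hEm).2 hin)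
    refine Measure.AbsolutelyContinuous.mk fun s hs h0 => ?_
    rw [Measure.restrict_apply hs] at h0
    exact measure_mono_null (t := (s ∩ E) ∪ Eᶜ) (fun x hx => by
      by_cases hxE : x ∈ E
      · exact Or.inl ⟨hx, hxE⟩
      · exact Or.inr hxE) (measure_union_null (hμπ h0) hμE)
  have hac : ∀ n : ℕ, (π.restrict E).bind (κ ^ n) ≪ π.restrict E := by
    intro n
    induction n with
    | zero =>
      rw [pow_zero]
      change (π.restrict E).bind Kernel.id ≪ _
      rw [Measure.id_comp]
    | succ n ih =>
      rw [pow_succ']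
      change (π.restrict E).bind (κ ∘ₖ (κ ^ n)) ≪ _
      rw [← Measure.comp_assoc]
      exact hac1 _ ih
  -- `S` is disjoint from `E`, so almost no point of `E` ever reaches it. If `E` had positive
  -- measure, one point would fail for all `n` at once, against `hreach`.
  have hnull : ∀ n, ∀ᵐ z ∂(π.restrict E), (κ ^ n) z S = 0 := by
    intro n
    have h0 : (π.restrict E) S = 0 := by
      rw [Measure.restrict_apply hS]
      convert measure_empty (μ := π)
      ext z
      simp only [Set.mem_inter_iff, Set.mem_empty_iff_false, iff_false, not_and]
      exact fun hz hzE => hzE (avoidProb_of_mem κ hS hz)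
    have h1 := hac n h0
    rwa [Measure.bind_apply hS (Kernel.aemeasurable _),
      lintegral_eq_zero_iff (Kernel.measurable_coe _ hS)] at h1
  have hzero : π.restrict E = 0 := by
    rw [← ae_eq_bot]
    by_contra hne
    have : (ae (π.restrict E)).NeBot := ⟨hne⟩
    obtain ⟨z, hz⟩ := (ae_all_iff.2 hnull).exists
    obtain ⟨n, hn⟩ := hreach z
    exact hn.ne' (hz n)
  rw [Measure.restrict_eq_zero] at hzero
  exact ae_iff.2 hzero

/-- A stationary irreducible chain whose moves, apart from staying put, are absolutely continuous
with respect to the stationary distribution is Harris recurrent. -/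
theorem harrisRecurrent_of_irreducible (κ : Kernel Z Z) [IsMarkovKernel κ] {π : Measure Z}
    [IsProbabilityMeasure π] (hinv : κ.Invariant π) (hirr : κ.IsIrreducible π)
    (hdec : ∀ z, ∃ (ρ : Measure Z) (c : ENNReal), ρ ≪ π ∧ κ z = ρ + c • Measure.dirac z) :
    HarrisRecurrent κ π := by
  intro S hS hpos z
  have hreach := hirr.irreducible hS hpos
  have hfm := measurable_avoidProb κ hS
  have hae := avoidProb_ae_eq_zero κ hinv hS hreach
  -- The part `ρ` sees only null sets of bad points, so harmonicity at `w` reduces to f(w) = c·f(w).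
  -- If f(w) ≠ 0 then c = 1 and ρ = 0, so `w` is absorbing and `S` is unreachable from it.
  have hzero : ∀ w, avoidProb κ S w = 0 := by
    intro w
    by_contra hw
    have hwS : w ∉ S := fun h => hw (avoidProb_of_mem κ hS h)
    obtain ⟨ρ, c, hρ, hκ⟩ := hdec w
    have h1 := avoidProb_of_notMem κ hS hwS
    rw [hκ, lintegral_add_measure, lintegral_smul_measure, lintegral_dirac' _ hfm,
      lintegral_congr_ae (hρ.ae_le hae), lintegral_zero, zero_add, smul_eq_mul] at h1
    have hc : c = 1 := by
      have hfin : avoidProb κ S w ≠ ⊤ :=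
        ne_top_of_le_ne_top ENNReal.one_ne_top (avoidProb_le_one κ S w)
      have h2 : 1 * avoidProb κ S w = c * avoidProb κ S w := by rw [one_mul]; exact h1
      exact ((ENNReal.mul_left_inj hw hfin).1 h2).symm
    have hρ0 : ρ = 0 := by
      have h3 : κ w Set.univ = 1 := measure_univ
      rw [hκ, hc, one_smul, Measure.add_apply, measure_univ (μ := Measure.dirac w)] at h3
      rw [← Measure.measure_univ_eq_zero]
      exact (ENNReal.add_left_inj ENNReal.one_ne_top).1 (h3.trans (zero_add _).symm)
    have hκw : κ w = Measure.dirac w := by rw [hκ, hc, hρ0, zero_add, one_smul]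
    have hpow : ∀ n, (κ ^ n) w = Measure.dirac w := by
      intro n
      induction n with
      | zero => rfl
      | succ n ih =>
        rw [pow_succ']
        change (κ ∘ₖ (κ ^ n)) w = _
        rw [Kernel.comp_apply, ih, Measure.dirac_bind (Kernel.measurable _), hκw]
    obtain ⟨n, hn⟩ := hreach w
    rw [hpow, Measure.dirac_apply' _ hS, Set.indicator_of_notMem hwS] at hn
    exact lt_irrefl _ hn
  -- `HarrisRecurrent` asks for a visit at a time at least 1, even from inside `S`, hence the
  -- integral over the first step.
  have h := measure_avoid_succ κ hS z
  simp only [hzero, lintegral_zero] at h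
  rw [chainLaw_dirac, ae_iff]
  simpa using h

end Recurrence

/-! ### The Metropolis–Hastings kernel: decomposition, invariance, reachability. -/

section MetropolisHastings

variable {Z : Type*}

/-- The acceptance probability, as a function of the current state and the candidate. -/
noncomputable def acceptProb (u : Z → ℝ) (z y : Z) : ENNReal :=
  ENNReal.ofReal (min 1 (u y / u z))

lemma acceptProb_le_one (u : Z → ℝ) (z y : Z) : acceptProb u z y ≤ 1 := by
  simp [acceptProb]

lemma acceptProb_pos {u : Z → ℝ} (hu : ∀ z, 0 < u z) (z y : Z) : 0 < acceptProb u z y :=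
  ENNReal.ofReal_pos.2 (lt_min one_pos (div_pos (hu y) (hu z)))

/-- The right side is symmetric in `z` and `y`; this is the source of detailed balance. -/
lemma ofReal_mul_acceptProb {u : Z → ℝ} (hu : ∀ z, 0 < u z) (z y : Z) :
    ENNReal.ofReal (u z) * acceptProb u z y = ENNReal.ofReal (min (u z) (u y)) := by
  rw [acceptProb, ← ENNReal.ofReal_mul (hu z).le, mul_min_of_nonneg _ _ (hu z).le, mul_one,
    mul_div_cancel₀ _ (hu z).ne']

variable [MeasurableSpace Z]

lemma measurable_acceptProb {u : Z → ℝ} (hu : Measurable u) :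
    Measurable (Function.uncurry (acceptProb u)) := by
  unfold Function.uncurry acceptProb; fun_prop

/-- Accepted moves have density `acceptProb` against the candidate law, and all rejected mass is an
atom at the current state. Both the balance computation and the Harris argument use this splitting.
-/
lemma mhKernel_apply (u : Z → ℝ) (hu : Measurable u) (Q : Kernel Z Z) [IsMarkovKernel Q] (z : Z) :
    mhKernel u hu Q z = (Q z).withDensity (acceptProb u z) +
      (∫⁻ y, (1 - acceptProb u z y) ∂(Q z)) • Measure.dirac z := by
  have hα : Measurable (acceptProb u z) := (measurable_acceptProb hu).of_uncurry_left
  have hβ : Measurable fun y => 1 - acceptProb u z y := measurable_const.sub hα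
  ext s hs
  rw [mhKernel, Kernel.comp_apply' _ _ _ hs, Kernel.prod_apply, Kernel.id_apply,
    Measure.dirac_prod, lintegral_map (Kernel.measurable_coe _ hs) measurable_prodMk_left]
  have h : ∀ y, acceptReject u hu (z, y) s = s.indicator (acceptProb u z) y +
      (1 - acceptProb u z y) * Measure.dirac z s := by
    intro y
    change (acceptProb u z y • Measure.dirac y + (1 - acceptProb u z y) • Measure.dirac z) s = _
    rw [Measure.add_apply, Measure.smul_apply, Measure.smul_apply, smul_eq_mul, smul_eq_mul,
      Measure.dirac_apply' y hs]
    by_cases hy : y ∈ s <;> simp [hy]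
  simp_rw [h]
  rw [lintegral_add_left (hα.indicator hs), lintegral_indicator hs,
    lintegral_mul_const _ hβ, Measure.add_apply, Measure.smul_apply,
    smul_eq_mul, withDensity_apply _ hs]

/-- Detailed balance gives invariance of the Metropolis-Hastings chain. -/
lemma mhKernel_invariant (u : Z → ℝ) (hu : Measurable u) (Q : Kernel Z Z) [IsMarkovKernel Q]
    {μ₀ : Measure Z} [SFinite μ₀] {q : Z → Z → ENNReal} (hq : Measurable (Function.uncurry q))
    (hQ : ∀ z, Q z = μ₀.withDensity (q z)) {w : Z → ENNReal} (hw : Measurable w)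
    (hbal : ∀ z y, w z * (q z y * acceptProb u z y) = w y * (q y z * acceptProb u y z)) :
    (mhKernel u hu Q).Invariant (μ₀.withDensity w) := by
  have hα := measurable_acceptProb hu
  have hαz : ∀ z, Measurable (acceptProb u z) := fun z => hα.of_uncurry_left
  have hqz : ∀ z, Measurable (q z) := fun z => hq.of_uncurry_left
  have hβz : ∀ z, Measurable fun y => 1 - acceptProb u z y :=
    fun z => measurable_const.sub (hαz z)
  have hqα : ∀ z, Measurable fun y => q z y * acceptProb u z y := fun z => (hqz z).mul (hαz z)
  have hqβ : ∀ z, Measurable fun y => q z y * (1 - acceptProb u z y) :=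
    fun z => (hqz z).mul (hβz z)
  have hF : Measurable (Function.uncurry fun z y => w z * (q z y * acceptProb u z y)) :=
    (hw.comp measurable_fst).mul (hq.mul hα)
  ext s hs
  have hI : Measurable (s.indicator (1 : Z → ENNReal)) := measurable_one.indicator hs
  set I := s.indicator (1 : Z → ENNReal) with hI'
  rw [Measure.bind_apply hs (Kernel.aemeasurable _),
    lintegral_withDensity_eq_lintegral_mul _ hw (Kernel.measurable_coe _ hs)]
  have h1 : ∀ z, mhKernel u hu Q z s = ∫⁻ y, q z y * acceptProb u z y * I y ∂μ₀ +
      ∫⁻ y, q z y * (1 - acceptProb u z y) * I z ∂μ₀ := by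
    intro z
    rw [mhKernel_apply, Measure.add_apply, Measure.smul_apply, smul_eq_mul,
      Measure.dirac_apply' _ hs, withDensity_apply _ hs, ← lintegral_indicator hs, hQ,
      lintegral_withDensity_eq_lintegral_mul _ (hqz z) ((hαz z).indicator hs),
      lintegral_withDensity_eq_lintegral_mul _ (hqz z) (hβz z),
      lintegral_mul_const _ (hqβ z)]
    congr 1
    refine lintegral_congr fun y => ?_
    by_cases hy : y ∈ s <;> simp [hI', hy]
  have h2 : ∀ z, (w * fun z => mhKernel u hu Q z s) z =
      ∫⁻ y, w z * (q z y * acceptProb u z y) * I y ∂μ₀ +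
      ∫⁻ y, w z * (q z y * (1 - acceptProb u z y)) * I z ∂μ₀ := by
    intro z
    have hqαI : Measurable fun y => q z y * acceptProb u z y * I y := (hqα z).mul hI
    rw [Pi.mul_apply, h1, mul_add, ← lintegral_const_mul _ hqαI,
      ← lintegral_const_mul _ ((hqβ z).mul_const _)]
    simp only [mul_assoc]
  have hm1 : Measurable (Function.uncurry fun z y => w z * (q z y * acceptProb u z y) * I y) :=
    hF.mul (hI.comp measurable_snd)
  have hm2 : Measurable fun z => ∫⁻ y, w z * (q z y * acceptProb u z y) * I y ∂μ₀ :=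
    hm1.lintegral_prod_right'
  have hm3 : Measurable fun y => ∫⁻ z, w z * (q z y * acceptProb u z y) * I y ∂μ₀ :=
    hm1.lintegral_prod_left'
  simp_rw [h2]
  -- Fubini turns the accepted flow out of `z` into the flow into `z`. By balance this equals the
  -- accepted outflow, which together with the rejected mass restores all of `w z * q z y`.
  rw [lintegral_add_left hm2, lintegral_lintegral_swap hm1.aemeasurable,
    ← lintegral_add_left hm3, withDensity_apply _ hs,
    ← lintegral_indicator hs]
  refine lintegral_congr fun z => ?_
  have hm4 : Measurable fun y => w y * (q y z * acceptProb u y z) * I z :=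
    (hF.of_uncurry_right (y := z)).mul_const _
  rw [← lintegral_add_left hm4]
  have h3 : ∀ y, w y * (q y z * acceptProb u y z) * I z +
      w z * (q z y * (1 - acceptProb u z y)) * I z = w z * I z * q z y := by
    intro y
    rw [hbal y z, ← add_mul, ← mul_add, ← mul_add,
      add_tsub_cancel_of_le (acceptProb_le_one u z y)]
    ring
  simp_rw [h3]
  rw [lintegral_const_mul _ (hqz z)]
  have h4 : ∫⁻ y, q z y ∂μ₀ = 1 := by
    have : Q z Set.univ = 1 := measure_univ
    rwa [hQ, withDensity_apply _ .univ, Measure.restrict_univ] at this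
  rw [h4, mul_one]
  by_cases hz : z ∈ s <;> simp [hI', hz]

/-- Irreducibility allows `n = 0`, but a candidate's outcome is freshly drawn only after a step.
Apply the hypothesis to a typical point one step after `z`. -/
lemma exists_pow_pos_imp_exists_pow_succ_pos {Q : Kernel Z Z} [IsMarkovKernel Q] {S : Set Z}
    (hS : MeasurableSet S) (h : ∀ z, ∃ n, 0 < (Q ^ n) z S) (z : Z) :
    ∃ n, 0 < (Q ^ (n + 1)) z S := by
  by_contra! hcon
  have h0 : ∀ n, ∀ᵐ y ∂(Q z), (Q ^ n) y S = 0 := by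
    intro n
    have h1 := hcon n
    rw [pow_succ] at h1
    change ((Q ^ n) ∘ₖ Q) z S ≤ 0 at h1
    rw [nonpos_iff_eq_zero, Kernel.comp_apply' _ _ _ hS,
      lintegral_eq_zero_iff (Kernel.measurable_coe _ hS)] at h1
    exact h1
  obtain ⟨y, hy⟩ := (ae_all_iff.2 h0).exists
  obtain ⟨n, hn⟩ := h y
  exact hn.ne' (hy n)

/-- If acceptance always has positive probability, then the Metropolis-Hastings chain reaches
whatever the chain of candidates reaches. -/
lemma mhKernel_pow_pos (u : Z → ℝ) (hu : Measurable u) (hpos : ∀ z, 0 < u z)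
    (Q : Kernel Z Z) [IsMarkovKernel Q] {S : Set Z} (hS : MeasurableSet S) (n : ℕ) :
    ∀ z, 0 < (Q ^ n) z S → 0 < (mhKernel u hu Q ^ n) z S := by
  induction n with
  | zero => intro z h; exact h
  | succ n ih =>
    intro z h
    rw [pow_succ] at h ⊢
    change 0 < ((Q ^ n) ∘ₖ Q) z S at h
    change 0 < ((mhKernel u hu Q ^ n) ∘ₖ mhKernel u hu Q) z S
    have hm := Kernel.measurable_coe (Q ^ n) hS
    have hm' := Kernel.measurable_coe (mhKernel u hu Q ^ n) hS
    have hα : Measurable (acceptProb u z) := (measurable_acceptProb hu).of_uncurry_left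
    rw [Kernel.comp_apply' _ _ _ hS] at h ⊢
    rw [pos_iff_ne_zero, Ne, lintegral_eq_zero_iff hm] at h
    rw [pos_iff_ne_zero, Ne, lintegral_eq_zero_iff hm', mhKernel_apply]
    refine fun h0 => h ?_
    have h1 := (Measure.absolutelyContinuous_of_le (Measure.le_add_right le_rfl)).ae_le h0
    -- The acceptance density is positive, so null sets of the accepted part are null for the
    -- candidate law.
    replace h1 := (ae_withDensity_iff hα).1 h1
    filter_upwards [h1] with y hy
    by_contra hne
    exact (ih y (pos_iff_ne_zero.2 hne)).ne' (hy (acceptProb_pos hpos z y).ne')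

end MetropolisHastings

/-! ### The augmented chain on (decision, outcome) pairs. -/

section Augmented

variable {X Θ : Type*} [MeasurableSpace X] [MeasurableSpace Θ]

/-- From `(x, θ)`, draw a decision from `g x`, then an outcome from `o`. -/
noncomputable def candidateKernel (g : Kernel X X) (o : Kernel X Θ) :
    Kernel (X × Θ) (X × Θ) :=
  ((Kernel.id ×ₖ o) ∘ₖ g).comap Prod.fst measurable_fst

instance (g : Kernel X X) (o : Kernel X Θ) [IsMarkovKernel g] [IsMarkovKernel o] :
    IsMarkovKernel (candidateKernel g o) := by
  unfold candidateKernel; infer_instance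

lemma lintegral_candidateKernel (g : Kernel X X) (o : Kernel X Θ) [IsMarkovKernel o]
    (z : X × Θ) {F : X × Θ → ENNReal} (hF : Measurable F) :
    ∫⁻ y, F y ∂(candidateKernel g o z) = ∫⁻ x, ∫⁻ θ, F (x, θ) ∂(o x) ∂(g z.1) := by
  rw [candidateKernel, Kernel.comap_apply, Kernel.lintegral_comp _ _ _ hF]
  simp_rw [Kernel.lintegral_id_prod hF]

/-- Candidates ignore the current outcome, so decisions evolve by `g` alone and only the last
outcome draw matters. -/
lemma candidateKernel_pow_succ_apply (g : Kernel X X) (o : Kernel X Θ) [IsMarkovKernel g]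
    [IsMarkovKernel o] {S : Set (X × Θ)} (hS : MeasurableSet S) (n : ℕ) :
    ∀ z, (candidateKernel g o ^ (n + 1)) z S =
      ∫⁻ x, o x (Prod.mk x ⁻¹' S) ∂((g ^ (n + 1)) z.1) := by
  have hm : Measurable fun x => o x (Prod.mk x ⁻¹' S) :=
    Kernel.measurable_kernel_prodMk_left hS
  induction n with
  | zero =>
    intro z
    rw [zero_add, pow_one, pow_one, ← lintegral_indicator_one hS,
      lintegral_candidateKernel _ _ _ (measurable_one.indicator hS)]
    refine lintegral_congr fun x => ?_
    rw [← lintegral_indicator_one (hS.preimage measurable_prodMk_left)]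
    rfl
  | succ n ih =>
    intro z
    rw [pow_succ, pow_succ g (n + 1)]
    change ((candidateKernel g o ^ (n + 1)) ∘ₖ candidateKernel g o) z S =
      ∫⁻ x, _ ∂(((g ^ (n + 1)) ∘ₖ g) z.1)
    rw [Kernel.comp_apply' _ _ _ hS, Kernel.lintegral_comp _ _ _ hm,
      lintegral_candidateKernel _ _ _ (Kernel.measurable_coe _ hS)]
    simp [ih]

/-- The distribution with density proportional to `u p`. -/
noncomputable def augMeasure (νX : Measure X) (νΘ : Measure Θ) (u p : X × Θ → ℝ) :
    Measure (X × Θ) :=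
  (νX.prod νΘ).withDensity fun z =>
    ENNReal.ofReal (u z * p z / ∫ w, u w * p w ∂(νX.prod νΘ))

lemma integral_mul_pos {νX : Measure X} {νΘ : Measure Θ} [SFinite νΘ] {u p : X × Θ → ℝ}
    (hX : νX ≠ 0) (hΘ : νΘ ≠ 0) (hupos : ∀ z, 0 < u z) (hppos : ∀ z, 0 < p z)
    (hint : Integrable (fun z => u z * p z) (νX.prod νΘ)) :
    0 < ∫ w, u w * p w ∂(νX.prod νΘ) := by
  rw [integral_pos_iff_support_of_nonneg (fun z => (mul_pos (hupos z) (hppos z)).le) hint]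
  have : (Function.support fun z => u z * p z) = Set.univ := by
    ext z; simp [(hupos z).ne', (hppos z).ne']
  rw [this, ← Set.univ_prod_univ, Measure.prod_prod]
  exact pos_iff_ne_zero.2 (mul_ne_zero (Measure.measure_univ_ne_zero.2 hX)
    (Measure.measure_univ_ne_zero.2 hΘ))

lemma isProbabilityMeasure_augMeasure {νX : Measure X} {νΘ : Measure Θ} {u p : X × Θ → ℝ}
    (hupos : ∀ z, 0 < u z) (hppos : ∀ z, 0 < p z)
    (hint : Integrable (fun z => u z * p z) (νX.prod νΘ))
    (hpos : 0 < ∫ w, u w * p w ∂(νX.prod νΘ)) :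
    IsProbabilityMeasure (augMeasure νX νΘ u p) := by
  refine ⟨?_⟩
  rw [augMeasure, withDensity_apply _ .univ, Measure.restrict_univ,
    ← ofReal_integral_eq_lintegral_ofReal (hint.div_const _)
      (ae_of_all _ fun z => (div_pos (mul_pos (hupos z) (hppos z)) hpos).le),
    integral_div, div_self hpos.ne', ENNReal.ofReal_one]

variable {νX : Measure X} {νΘ : Measure Θ} [SigmaFinite νX] [SigmaFinite νΘ]

lemma Proposal.kernel_apply (G : Proposal X νX) (x : X) :
    G.kernel x = νX.withDensity fun y => ENNReal.ofReal (G.g y x) := by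
  have hm : Measurable (Function.uncurry fun x y => ENNReal.ofReal (G.g y x)) :=
    (G.measurable.comp measurable_swap).ennreal_ofReal
  rw [Proposal.kernel, Kernel.withDensity_apply _ hm, Kernel.const_apply]

lemma candidateKernel_apply (G : Proposal X νX) (o : Kernel X Θ) [IsMarkovKernel o]
    {p : X × Θ → ℝ} (hp : Measurable p)
    (ho : ∀ x, o x = νΘ.withDensity fun θ => ENNReal.ofReal (p (x, θ))) (z : X × Θ) :
    candidateKernel G.kernel o z = (νX.prod νΘ).withDensity
      fun y => ENNReal.ofReal (G.g y.1 z.1) * ENNReal.ofReal (p y) := by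
  have hg : Measurable fun x => ENNReal.ofReal (G.g x z.1) :=
    (G.measurable.comp measurable_prodMk_right).ennreal_ofReal
  refine Measure.ext_of_lintegral _ fun F hF => ?_
  have hm : Measurable fun y : X × Θ => ENNReal.ofReal (G.g y.1 z.1) * ENNReal.ofReal (p y) :=
    (hg.comp measurable_fst).mul hp.ennreal_ofReal
  have ho' : Measurable fun x => ∫⁻ θ, F (x, θ) ∂(o x) := hF.lintegral_kernel_prod_right'
  rw [lintegral_candidateKernel _ _ _ hF, lintegral_withDensity_eq_lintegral_mul _ hm hF,
    lintegral_prod _ (hm.mul hF).aemeasurable, Proposal.kernel_apply,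
    lintegral_withDensity_eq_lintegral_mul _ hg ho']
  refine lintegral_congr fun x => ?_
  have hpx : Measurable fun θ => ENNReal.ofReal (p (x, θ)) :=
    (hp.comp measurable_prodMk_left).ennreal_ofReal
  have hFx : Measurable fun θ => F (x, θ) := hF.comp measurable_prodMk_left
  have hpF : Measurable fun θ => ENNReal.ofReal (p (x, θ)) * F (x, θ) := hpx.mul hFx
  simp only [Pi.mul_apply, mul_assoc]
  rw [ho, lintegral_withDensity_eq_lintegral_mul _ hpx hFx, lintegral_const_mul _ hpF]
  rfl

variable (G : Proposal X νX) {u p : X × Θ → ℝ} {o : Kernel X Θ} [IsMarkovKernel o]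

lemma mhKernel_candidateKernel_isIrreducible (hu : Measurable u) (hupos : ∀ z, 0 < u z)
    (hp : Measurable p) (hppos : ∀ z, 0 < p z)
    (ho : ∀ x, o x = νΘ.withDensity fun θ => ENNReal.ofReal (p (x, θ)))
    (hirr : G.kernel.IsIrreducible νX) {π : Measure (X × Θ)} (hπ : π ≪ νX.prod νΘ) :
    (mhKernel u hu (candidateKernel G.kernel o)).IsIrreducible π := by
  refine ⟨fun S hS hpos z => ?_⟩
  have hm : Measurable fun x => o x (Prod.mk x ⁻¹' S) :=
    Kernel.measurable_kernel_prodMk_left hS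
  -- Since `νΘ ≪ o x`, a set `S` whose `B` is null would have null sections almost everywhere; hence
  -- `νX B > 0`, and it suffices that the proposal reaches `B`.
  set B : Set X := {x | o x (Prod.mk x ⁻¹' S) ≠ 0} with hB
  have hBm : MeasurableSet B := (hm (measurableSet_singleton 0)).compl
  have hac : ∀ x, νΘ ≪ o x := by
    intro x
    rw [ho]
    exact withDensity_absolutelyContinuous'
      (hp.comp measurable_prodMk_left).ennreal_ofReal.aemeasurable
      (ae_of_all _ fun θ => (ENNReal.ofReal_pos.2 (hppos _)).ne')
  have hνB : 0 < νX B := by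
    rw [pos_iff_ne_zero]
    intro h0
    refine hpos.ne' (hπ ?_)
    rw [Measure.prod_apply hS, lintegral_eq_zero_iff (measurable_measure_prodMk_left hS)]
    have h1 : ∀ᵐ x ∂νX, x ∉ B := measure_eq_zero_iff_ae_notMem.1 h0
    filter_upwards [h1] with x hx
    exact hac x (by simpa [hB] using hx)
  obtain ⟨n, hn⟩ := exists_pow_pos_imp_exists_pow_succ_pos hBm (hirr.irreducible hBm hνB) z.1
  refine ⟨n + 1, mhKernel_pow_pos u hu hupos _ hS _ z ?_⟩
  rw [candidateKernel_pow_succ_apply _ _ hS, lintegral_pos_iff_support hm]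
  exact hn

lemma mhKernel_invariant_augMeasure (hu : Measurable u) (hupos : ∀ z, 0 < u z)
    (hp : Measurable p) (hppos : ∀ z, 0 < p z)
    (ho : ∀ x, o x = νΘ.withDensity fun θ => ENNReal.ofReal (p (x, θ)))
    (hsymm : G.Symmetric) :
    (mhKernel u hu (candidateKernel G.kernel o)).Invariant (augMeasure νX νΘ u p) := by
  refine mhKernel_invariant u hu _
    (q := fun z y => ENNReal.ofReal (G.g y.1 z.1) * ENNReal.ofReal (p y)) ?_
    (candidateKernel_apply G o hp ho) (by fun_prop) fun z y => ?_
  · have h1 : Measurable fun w : (X × Θ) × (X × Θ) => G.g w.2.1 w.1.1 :=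
      G.measurable.comp (f := fun w : (X × Θ) × (X × Θ) => (w.2.1, w.1.1)) (by fun_prop)
    exact h1.ennreal_ofReal.mul (hp.comp measurable_snd).ennreal_ofReal
  · have key : ∀ z : X × Θ, ENNReal.ofReal (u z * p z / ∫ w, u w * p w ∂(νX.prod νΘ)) =
        ENNReal.ofReal (u z) * (ENNReal.ofReal (p z) *
          ENNReal.ofReal (∫ w, u w * p w ∂(νX.prod νΘ))⁻¹) := by
      intro z
      rw [← ENNReal.ofReal_mul (hppos z).le, ← ENNReal.ofReal_mul (hupos z).le]
      congr 1
      ring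
    rw [key, key, hsymm y.1 z.1]
    -- Regroups so that utility and acceptance probability are adjacent and merge into the minimum
    -- of the two utilities.
    have e : ∀ a b c d e f : ENNReal, a * (b * c) * (d * e * f) = (a * f) * (b * e * c * d) := by
      intros; ring
    rw [e, e, ofReal_mul_acceptProb hupos, ofReal_mul_acceptProb hupos, min_comm]
    ring

lemma mhKernel_harrisRecurrent (hu : Measurable u) (hupos : ∀ z, 0 < u z)
    (hp : Measurable p) (hppos : ∀ z, 0 < p z)
    (ho : ∀ x, o x = νΘ.withDensity fun θ => ENNReal.ofReal (p (x, θ)))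
    (hsymm : G.Symmetric) (hirr : G.kernel.IsIrreducible νX)
    (hint : Integrable (fun z => u z * p z) (νX.prod νΘ))
    (hpos : 0 < ∫ w, u w * p w ∂(νX.prod νΘ)) :
    HarrisRecurrent (mhKernel u hu (candidateKernel G.kernel o)) (augMeasure νX νΘ u p) := by
  have := isProbabilityMeasure_augMeasure hupos hppos hint hpos
  refine harrisRecurrent_of_irreducible _
    (mhKernel_invariant_augMeasure G hu hupos hp hppos ho hsymm)
    (mhKernel_candidateKernel_isIrreducible G hu hupos hp hppos ho hirr
      (withDensity_absolutelyContinuous _ _)) fun z => ?_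
  -- The accepted part is absolutely continuous with respect to the product reference measure, hence
  -- to the target, whose density is everywhere positive.
  refine ⟨_, _, ?_, mhKernel_apply u hu _ z⟩
  refine (withDensity_absolutelyContinuous _ _).trans ?_
  rw [candidateKernel_apply G o hp ho]
  refine (withDensity_absolutelyContinuous _ _).trans
    (withDensity_absolutelyContinuous' (by fun_prop) (ae_of_all _ fun z => ?_))
  exact (ENNReal.ofReal_pos.2 (div_pos (mul_pos (hupos z) (hppos z)) hpos)).ne'

/-- Tonelli; integrability at every `x` turns the inner lower integral into the Bochner integral
used in `margDensityA` and `margDensityD`. -/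
lemma augMeasure_fst (hu : Measurable u) (hupos : ∀ z, 0 < u z)
    (hp : Measurable p) (hppos : ∀ z, 0 < p z)
    (hintx : ∀ x, Integrable (fun θ => u (x, θ) * p (x, θ)) νΘ)
    (hpos : 0 < ∫ w, u w * p w ∂(νX.prod νΘ)) :
    (augMeasure νX νΘ u p).fst = νX.withDensity fun x => ENNReal.ofReal
      (∫ θ, u (x, θ) * p (x, θ) / ∫ w, u w * p w ∂(νX.prod νΘ) ∂νΘ) := by
  ext s hs
  rw [Measure.fst_apply hs, augMeasure, withDensity_apply _ (hs.preimage measurable_fst),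
    withDensity_apply _ hs, ← Set.prod_univ, ← Measure.prod_restrict, Measure.restrict_univ,
    lintegral_prod _ (by fun_prop)]
  refine lintegral_congr fun x => ?_
  rw [ofReal_integral_eq_lintegral_ofReal ((hintx x).div_const _)
    (ae_of_all _ fun θ => (div_pos (mul_pos (hupos _) (hppos _)) hpos).le)]

end Augmented

/-! ### Mode estimates with arbitrary initial law and burn-in. -/

section Estimation

/-- Provides measurability of the convergence event and uniqueness of limits. -/
lemma DiscreteOrInterval.secondCountable_metrizable {X : Type*} [TopologicalSpace X] [MeasurableSpace X]
    (ν : Measure X) [h : DiscreteOrInterval X ν] :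
    ∃ (_ : SecondCountableTopology X), TopologicalSpace.MetrizableSpace X := by
  rcases h.discrete_or_interval with ⟨_, _, _⟩ | ⟨n, I, e, _, he, _⟩
  · exact ⟨inferInstance, inferInstance⟩
  · exact ⟨he.secondCountableTopology, he.metrizableSpace⟩

/-- A consistent mode estimator converges along a positive Harris recurrent chain with any initial
law and any burn-in. -/
lemma IsConsistentModeEstimator.ae_tendsto {X Y : Type*} [TopologicalSpace X]
    [MeasurableSpace X] [BorelSpace X] [MeasurableSpace Y] {ν : Measure X}
    [DiscreteOrInterval X ν] {T : (n : ℕ) → (Fin n → X) → X} {f : X → ℝ}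
    (hT : IsConsistentModeEstimator ν Y T f) {m : X} (hm : IsMode f m)
    (κ : Kernel (X × Y) (X × Y)) [IsMarkovKernel κ] {μ : Measure (X × Y)}
    [IsProbabilityMeasure μ] (hinv : κ.Invariant μ) (hH : HarrisRecurrent κ μ)
    (hμ : μ.fst = ν.withDensity fun x => ENNReal.ofReal (f x))
    (init : Measure (X × Y)) [IsProbabilityMeasure init] (burn : ℕ) :
    ∀ᵐ x ∂(chainLaw init κ), Tendsto (fun N => modeEstimate T burn N x) atTop (𝓝 m) := by
  obtain ⟨_, _⟩ := DiscreteOrInterval.secondCountable_metrizable ν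
  have hmeas : ∀ N, Measurable fun x : ℕ → X × Y => modeEstimate T 0 N x := by
    intro N
    exact (hT.1 (N - 0)).comp (measurable_pi_lambda _ fun i =>
      (measurable_pi_apply _).fst)
  have hset : MeasurableSet {x : ℕ → X × Y |
      Tendsto (fun N => modeEstimate T 0 N x) atTop (𝓝 m)} :=
    measurableSet_tendsto _ hmeas
  filter_upwards [ae_chainLaw_shift init κ burn hset (hT.2 m hm κ μ hinv hH hμ)] with x hx
  -- The estimate with burn-in from `N` draws is the one without burn-in from `N - burn` draws of
  -- the shifted path.
  have h := hx.comp (tendsto_sub_atTop_nat burn)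
  refine h.congr fun N => ?_
  simp only [Function.comp_apply, modeEstimate, Nat.sub_zero]
  congr 1
  ext i
  rw [zero_add, add_assoc]

end Estimation

/-! ### Specialization to the game and the main theorem. -/

lemma Proposal.measure_ne_zero {X : Type*} [MeasurableSpace X] [Nonempty X] {ν : Measure X}
    (G : Proposal X ν) : ν ≠ 0 := by
  intro h
  have := G.lintegral_eq_one (Classical.arbitrary X)
  simp [h] at this

namespace DefendAttackGame

variable {D A Θ : Type*} [MeasurableSpace D] [MeasurableSpace A] [MeasurableSpace Θ]
  {νΘ : Measure Θ} [SFinite νΘ] (G : DefendAttackGame D A Θ νΘ)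

lemma outcomeA_apply (x : D × A) :
    G.outcomeA x = νΘ.withDensity fun θ => ENNReal.ofReal (G.pA x.1 x.2 θ) := by
  rw [outcomeA, Kernel.withDensity_apply _ G.measurable_pA.ennreal_ofReal, Kernel.const_apply]

lemma outcomeD_apply (x : D × A) :
    G.outcomeD x = νΘ.withDensity fun θ => ENNReal.ofReal (G.pD x.1 x.2 θ) := by
  rw [outcomeD, Kernel.withDensity_apply _ G.measurable_pD.ennreal_ofReal, Kernel.const_apply]

/-- With a fixed response table, the outcome draw has a density depending on `d` alone, as the
augmented chain requires. -/
lemma outcomeD_comp_deterministic_apply {r : D → A} (hr : Measurable r) (d : D) :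
    (G.outcomeD ∘ₖ (Kernel.id ×ₖ Kernel.deterministic r hr)) d =
      νΘ.withDensity fun θ => ENNReal.ofReal (G.pD d (r d) θ) := by
  rw [Kernel.comp_apply, Kernel.prod_apply, Kernel.id_apply, Kernel.deterministic_apply,
    Measure.dirac_prod_dirac, Measure.dirac_bind (Kernel.measurable _), outcomeD_apply]

end DefendAttackGame

theorem proposition1
    {D A Θ : Type*}
    [TopologicalSpace D] [MeasurableSpace D] [BorelSpace D]
    [TopologicalSpace A] [MeasurableSpace A] [BorelSpace A] [Nonempty A]
    [TopologicalSpace Θ] [MeasurableSpace Θ] [BorelSpace Θ]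
    (νD : Measure D) (νA : Measure A) (νΘ : Measure Θ)
    -- the sets `𝒟`, `𝒜`, `Θ` are discrete or intervals in `ℝⁿ`
    [DiscreteOrInterval D νD] [DiscreteOrInterval A νA] [DiscreteOrInterval Θ νΘ]
    (G : DefendAttackGame D A Θ νΘ)
    -- positivity of utilities and outcome densities
    (huA : ∀ a θ, 0 < G.uA a θ) (huD : ∀ d θ, 0 < G.uD d θ)
    (hpA : ∀ d a θ, 0 < G.pA d a θ) (hpD : ∀ d a θ, 0 < G.pD d a θ)
    -- the best response `a*` of the Attacker and the optimal defense `d*_GT`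
    (astar : D → A) (hastar_meas : Measurable astar)
    (hastar : ∀ d a, a ≠ astar d → G.psiA d a < G.psiA d (astar d))
    (dGT : D) (hdGT : ∀ d, d ≠ dGT → G.psiD d (astar d) < G.psiD dGT (astar dGT))
    -- integrability of the products of utilities and probabilities
    (hintA : ∀ d a, Integrable (fun θ => G.uA a θ * G.pA d a θ) νΘ)
    (hintD : ∀ d a, Integrable (fun θ => G.uD d θ * G.pD d a θ) νΘ)
    (hintA' : ∀ d, Integrable (fun z : A × Θ => G.uA z.1 z.2 * G.pA d z.1 z.2) (νA.prod νΘ))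
    (hintD' : Integrable (fun z : D × Θ => G.uD z.1 z.2 * G.pD z.1 (astar z.1) z.2)
      (νD.prod νΘ))
    -- symmetric proposals, whose own Markov chains are irreducible
    (gA : Proposal A νA) (gD : Proposal D νD) (hgA : gA.Symmetric) (hgD : gD.Symmetric)
    (hirrA : gA.kernel.IsIrreducible νA) (hirrD : gD.kernel.IsIrreducible νD)
    -- consistent mode estimators for the inner and the outer samples
    (TA : (n : ℕ) → (Fin n → A) → A) (TD : (n : ℕ) → (Fin n → D) → D)
    (hTA : ∀ d, IsConsistentModeEstimator νA Θ TA (G.margDensityA νA d))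
    (hTD : IsConsistentModeEstimator νD Θ TD (G.margDensityD νD astar))
    -- burn-in lengths, and initial attacks of the inner chains
    (K R : ℕ) (a₀ : D → A) :
    -- the inner chains have stationary distribution `π_A(· ∣ d)`, and the estimated responses
    -- converge to `a*(d)` almost surely
    (∀ d, IsProbabilityMeasure (G.augA νA d) ∧
      (G.innerKernel gA d).Invariant (G.augA νA d) ∧
      IsMode (G.margDensityA νA d) (astar d) ∧
      ∀ᵐ x ∂(G.innerLaw gA d (a₀ d)),
        Tendsto (fun M => modeEstimate TA K M x) atTop (𝓝 (astar d))) ∧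
    -- for every table `r` of recorded responses, the outer chain has stationary distribution
    -- `π_D(d, θ ∣ r(d))`
    (∀ r : D → A, ∀ hr : Measurable r,
      Integrable (fun z : D × Θ => G.uD z.1 z.2 * G.pD z.1 (r z.1) z.2) (νD.prod νΘ) →
      IsProbabilityMeasure (G.augD νD r) ∧
      (G.outerKernel gD (Kernel.deterministic r hr)).Invariant (G.augD νD r)) ∧
    -- the nested chain, in which each response is computed by its inner chain
    ∃ (solve : Kernel D A) (_ : IsMarkovKernel solve),
      (∀ d, solve d = G.responseLaw gA TA K a₀ d) ∧
      IsProbabilityMeasure (G.augD νD astar) ∧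
      (G.outerKernel gD solve).Invariant (G.augD νD astar) ∧
      IsMode (G.margDensityD νD astar) dGT ∧
      ∀ d₀ : D, ∀ᵐ x ∂(G.outerLaw gD solve d₀),
        Tendsto (fun N => modeEstimate TD R N x) atTop (𝓝 dGT) := by
  have : Nonempty D := ⟨dGT⟩
  have hνΘ : νΘ ≠ 0 := by
    rintro h
    have h1 := G.lintegral_pA dGT (astar dGT)
    simp [h] at h1
  have hνA := gA.measure_ne_zero
  have hνD := gD.measure_ne_zero
  have inner : ∀ d, IsProbabilityMeasure (G.augA νA d) ∧
      (G.innerKernel gA d).Invariant (G.augA νA d) ∧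
      IsMode (G.margDensityA νA d) (astar d) ∧
      ∀ᵐ x ∂(G.innerLaw gA d (a₀ d)),
        Tendsto (fun M => modeEstimate TA K M x) atTop (𝓝 (astar d)) := by
    intro d
    have hp : Measurable fun z : A × Θ => G.pA d z.1 z.2 :=
      G.measurable_pA.comp (f := fun z : A × Θ => ((d, z.1), z.2)) (by fun_prop)
    have hu := G.measurable_uA
    have hup : ∀ z : A × Θ, 0 < G.uA z.1 z.2 := fun z => huA _ _
    have hpp : ∀ z : A × Θ, 0 < G.pA d z.1 z.2 := fun z => hpA _ _ _
    have ho : ∀ a, G.outcomeA.comap (fun a => (d, a)) measurable_prodMk_left a =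
        νΘ.withDensity fun θ => ENNReal.ofReal (G.pA d a θ) := fun a => G.outcomeA_apply (d, a)
    have hpos := integral_mul_pos hνA hνΘ hup hpp (hintA' d)
    have hprob : IsProbabilityMeasure (G.augA νA d) :=
      isProbabilityMeasure_augMeasure hup hpp (hintA' d) hpos
    -- `innerKernel` unfolds to `mhKernel` over a `candidateKernel`, so the general lemma applies by
    -- definitional unfolding.
    have hinv : (G.innerKernel gA d).Invariant (G.augA νA d) :=
      mhKernel_invariant_augMeasure gA hu hup hp hpp ho hgA
    have hmode : IsMode (G.margDensityA νA d) (astar d) := by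
      intro a ha
      simp only [DefendAttackGame.margDensityA, DefendAttackGame.augDensityA, integral_div]
      exact div_lt_div_of_pos_right (hastar d a ha) hpos
    have : IsProbabilityMeasure ((G.outcomeA (d, a₀ d)).map fun θ => (a₀ d, θ)) :=
      Measure.isProbabilityMeasure_map (by fun_prop)
    exact ⟨hprob, hinv, hmode, (hTA d).ae_tendsto hmode _ hinv
      (mhKernel_harrisRecurrent gA hu hup hp hpp ho hgA hirrA (hintA' d) hpos)
      (augMeasure_fst hu hup hp hpp (hintA d) hpos) _ K⟩
  have outer : ∀ r : D → A, ∀ hr : Measurable r,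
      Integrable (fun z : D × Θ => G.uD z.1 z.2 * G.pD z.1 (r z.1) z.2) (νD.prod νΘ) →
      (0 < ∫ z : D × Θ, G.uD z.1 z.2 * G.pD z.1 (r z.1) z.2 ∂(νD.prod νΘ)) ∧
      IsProbabilityMeasure (G.augD νD r) ∧
      (G.outerKernel gD (Kernel.deterministic r hr)).Invariant (G.augD νD r) ∧
      HarrisRecurrent (G.outerKernel gD (Kernel.deterministic r hr)) (G.augD νD r) := by
    intro r hr hint
    have hp : Measurable fun z : D × Θ => G.pD z.1 (r z.1) z.2 :=
      G.measurable_pD.comp (f := fun z : D × Θ => ((z.1, r z.1), z.2)) (by fun_prop)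
    have hu := G.measurable_uD
    have hup : ∀ z : D × Θ, 0 < G.uD z.1 z.2 := fun z => huD _ _
    have hpp : ∀ z : D × Θ, 0 < G.pD z.1 (r z.1) z.2 := fun z => hpD _ _ _
    have ho := G.outcomeD_comp_deterministic_apply hr
    have hpos := integral_mul_pos hνD hνΘ hup hpp hint
    exact ⟨hpos, isProbabilityMeasure_augMeasure hup hpp hint hpos,
      mhKernel_invariant_augMeasure gD hu hup hp hpp ho hgD,
      mhKernel_harrisRecurrent gD hu hup hp hpp ho hgD hirrD hint hpos⟩
  -- The response kernel is the Dirac kernel at `astar`; its measurability in `d` comes from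
  -- `hastar_meas`.
  refine ⟨inner, fun r hr hint => ⟨(outer r hr hint).2.1, (outer r hr hint).2.2.1⟩,
    Kernel.deterministic astar hastar_meas, inferInstance, fun d => ?_, ?_⟩
  · obtain ⟨_, _⟩ := DiscreteOrInterval.secondCountable_metrizable νA
    have : IsProbabilityMeasure ((G.outcomeA (d, a₀ d)).map fun θ => (a₀ d, θ)) :=
      Measure.isProbabilityMeasure_map (by fun_prop)
    have : IsProbabilityMeasure (G.innerLaw gA d (a₀ d)) := by
      unfold DefendAttackGame.innerLaw; infer_instance
    -- The limit map equals a constant almost surely, so its pushforward is computed without a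
    -- separate measurability proof for `limUnder`.
    have h : (fun x => limUnder atTop fun M => modeEstimate TA K M x)
        =ᵐ[G.innerLaw gA d (a₀ d)] fun _ => astar d := by
      filter_upwards [(inner d).2.2.2] with x hx
      exact hx.limUnder_eq
    rw [DefendAttackGame.responseLaw, Measure.map_congr h, Measure.map_const, measure_univ,
      one_smul, Kernel.deterministic_apply]
  · obtain ⟨hpos, hprob, hinv, hH⟩ := outer astar hastar_meas hintD'
    have hmode : IsMode (G.margDensityD νD astar) dGT := by
      intro d hd
      simp only [DefendAttackGame.margDensityD, DefendAttackGame.augDensityD, integral_div]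
      exact div_lt_div_of_pos_right (hdGT d hd) hpos
    have hp : Measurable fun z : D × Θ => G.pD z.1 (astar z.1) z.2 :=
      G.measurable_pD.comp (f := fun z : D × Θ => ((z.1, astar z.1), z.2)) (by fun_prop)
    refine ⟨hprob, hinv, hmode, fun d₀ => ?_⟩
    have : IsProbabilityMeasure
        (G.attachOutcome (Kernel.deterministic astar hastar_meas) d₀) := by
      unfold DefendAttackGame.attachOutcome; infer_instance
    exact hTD.ae_tendsto hmode _ hinv hH
      (augMeasure_fst (u := fun z => G.uD z.1 z.2) (p := fun z => G.pD z.1 (astar z.1) z.2)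
        G.measurable_uD (fun z => huD _ _) hp (fun z => hpD _ _ _)
        (fun d => hintD d (astar d)) hpos) _ R
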